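/- Let $H$ be a complex Hilbert space with norm $|\cdot|$ and inner product $\langle\cdot,\cdot\rangle$ (linear in the first entry). Let $A$ be an operator in $H$ with domain $D(A)$ such that $-A$ is the generator of a uniformly bounded, holomorphic semigroup $e^{-tA}$; that is, $-A$ is the infinitesimal generator of a strongly continuous semigroup with $\sup_{t\ge 0}\|e^{-tA}\|<\infty$ which, for some $\delta\in\,]0,\frac{\pi}{2}[$, extends to a family $e^{-zA}$ of bounded operators depending holomorphically on $z$ in the sector $\Sigma_\delta=\{z\in\mathbb{C}\setminus\{0\} : |\arg z|<\delta\}$, with $e^{-(z+w)A}=e^{-zA}e^{-wA}$ for $z,w\in\Sigma_\delta$ and $e^{-zA}x\to x$ as $z\to0$ in $\Sigma_\delta$ for every $x\in H$. For an operator $B$ in $H$ write $\nu(B)=\{\langle Bx,x\rangle : x\in D(B),\ |x|=1\}$ for its numerical range and $m(B)=\inf\operatorname{Re}\nu(B)$, and let $D(A^2)=\{x\in D(A) : Ax\in D(A)\}$. Suppose that $$\nu(A)\subset\{z\in\mathbb{C} : \operatorname{Re}z>0\},\qquad \nu(A^2)\subset\{z\in\mathbb{C} : \operatorname{Re}z\ge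 0\}.$$ Then, for every $u_0\in H$ with $u_0\neq0$, the height function $h(t)=|e^{-tA}u_0|$, $t\ge0$, has the following properties. 1. $h$ is strictly convex and strictly decreasing on $[0,\infty[$; moreover $h\in C^\infty(]0,\infty[,\mathbb{R})$ and $h''(t)>0$ for every $t>0$. 2. $h$ is differentiable from the right at $t=0$ in the extended sense: the limit $h'(0)=\lim_{t\to0^+}\frac{h(t)-h(0)}{t}$ exists in $[-\infty,0]$, and $h'(0)=\inf_{t>0}h'(t)$. If $|u_0|=1$, then $h'(0)\le -m(A)$. 3. If $u_0\in D(A)$ and $|u_0|=1$, then $h'(0)=-\operatorname{Re}\langle Au_0,u_0\rangle$ (in particular $h'(0)$ is finite) and $h\in C^1([0,\infty[,\mathbb{R})$. -/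

import Mathlib

open Set Filter Topology
open scoped ContDiff

namespace HolSemigroup

/-- The open sector `Σ_δ = {z ≠ 0 : -δ < arg z < δ}` in the complex plane. -/
def sector (δ : ℝ) : Set ℂ := {z : ℂ | z ≠ 0 ∧ |z.arg| < δ}

variable {H : Type*} [NormedAddCommGroup H] [InnerProductSpace ℂ H]

/-- `T` is a semigroup of bounded operators on `H` that is holomorphic in the sector `Σ_δ`:
`T 0 = I`, the semigroup law and operator-valued holomorphy hold in `Σ_δ`, and
`T z x → x` as `z → 0` in `Σ_δ`.  The values of `T` outside `Σ_δ ∪ {0}` are irrelevant. -/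
structure IsHolomorphicOn (δ : ℝ) (T : ℂ → H →L[ℂ] H) : Prop where
  map_zero : T 0 = ContinuousLinearMap.id ℂ H
  map_add : ∀ z ∈ sector δ, ∀ w ∈ sector δ, T (z + w) = (T z).comp (T w)
  differentiableOn : DifferentiableOn ℂ T (sector δ)
  tendsto_zero : ∀ x : H, Tendsto (fun z => T z x) (𝓝[sector δ] 0) (𝓝 x)

/-- `T` is a uniformly bounded, holomorphic semigroup: it is holomorphic in some sector `Σ_δ`
with `0 < δ < π / 2`, and `‖T t‖ ≤ M` for all real `t ≥ 0`. -/
def IsBoundedHolomorphic (T : ℂ → H →L[ℂ] H) : Prop :=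
  (∃ δ : ℝ, 0 < δ ∧ δ < Real.pi / 2 ∧ IsHolomorphicOn δ T) ∧
    ∃ M : ℝ, ∀ t : ℝ, 0 ≤ t → ‖T (t : ℂ)‖ ≤ M

/-- `B` is the infinitesimal generator of `(T t)_{t ≥ 0}`: its domain consists of all `x` for which
`(T t x - x) / t` converges as `t → 0⁺`, and `B x` is the limit. -/
def Generates (B : H →ₗ.[ℂ] H) (T : ℂ → H →L[ℂ] H) : Prop :=
  ∀ x y : H, (x, y) ∈ B.graph ↔
    Tendsto (fun t : ℝ => ((t : ℂ)⁻¹) • (T (t : ℂ) x - x)) (𝓝[>] (0 : ℝ)) (𝓝 y)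

/-- The square of an unbounded operator, with domain `D(A²) = {x ∈ D(A) : A x ∈ D(A)}`. -/
def sq (A : H →ₗ.[ℂ] H) : H →ₗ.[ℂ] H where
  domain :=
    { carrier := {x : H | ∃ hx : x ∈ A.domain, A ⟨x, hx⟩ ∈ A.domain}
      zero_mem' := ⟨A.domain.zero_mem, by
        have h : A ⟨0, A.domain.zero_mem⟩ = 0 := A.map_zero
        rw [h]; exact A.domain.zero_mem⟩
      add_mem' := by
        rintro x y ⟨hx, hAx⟩ ⟨hy, hAy⟩
        refine ⟨A.domain.add_mem hx hy, ?_⟩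
        have h : A ⟨x + y, A.domain.add_mem hx hy⟩ = A ⟨x, hx⟩ + A ⟨y, hy⟩ :=
          A.map_add ⟨x, hx⟩ ⟨y, hy⟩
        rw [h]; exact A.domain.add_mem hAx hAy
      smul_mem' := by
        rintro c x ⟨hx, hAx⟩
        refine ⟨A.domain.smul_mem c hx, ?_⟩
        have h : A ⟨c • x, A.domain.smul_mem c hx⟩ = c • A ⟨x, hx⟩ := A.map_smul c ⟨x, hx⟩
        rw [h]; exact A.domain.smul_mem c hAx }
  toFun :=
    { toFun := fun x => A ⟨A ⟨x.1, x.2.1⟩, x.2.2⟩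
      map_add' := by
        intro x y
        rw [← A.map_add]
        congr 1
        exact Subtype.ext (A.map_add ⟨x.1, x.2.1⟩ ⟨y.1, y.2.1⟩)
      map_smul' := by
        intro c x
        rw [RingHom.id_apply, ← A.map_smul]
        congr 1
        exact Subtype.ext (A.map_smul c ⟨x.1, x.2.1⟩) }

/-- The numerical range `ν(A) = {⟨A x, x⟩ : x ∈ D(A), |x| = 1}`, where `⟨·, ·⟩` is linear in its
first entry (Mathlib's `inner ℂ` is linear in the last one). -/
def numRange (A : H →ₗ.[ℂ] H) : Set ℂ :=
  {z : ℂ | ∃ x : A.domain, ‖(x : H)‖ = 1 ∧ z = inner ℂ (x : H) (A x)}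

/-- The lower bound `m(A) = inf Re ν(A)`, as an extended real number. -/
noncomputable def lowerBound (A : H →ₗ.[ℂ] H) : EReal :=
  ⨅ z ∈ numRange A, (z.re : EReal)

/-- The height function `h(t) = |T t u₀|`. -/
noncomputable def height (T : ℂ → H →L[ℂ] H) (u₀ : H) : ℝ → ℝ :=
  fun t => ‖T (t : ℂ) u₀‖

end HolSemigroup

namespace HolSemigroup

/-! For `t > 0` the orbit `u = T t u₀` is smooth with `u' = -Au` and `u'' = A²u`, and it never
vanishes, by the identity theorem (`orbit_ne_zero`). Hence `h' = Re⟨u', u⟩/|u| < 0`, and `|u|³h'' =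
|u|²(|u'|² + Re⟨u'', u⟩) - (Re⟨u', u⟩)²` (`deriv_deriv_norm`). This is nonnegative by Cauchy-Schwarz
and the condition on `A²`. Equality would force `u' = au` with `a` real; `a ≠ 0` since `h' < 0`, so
`Re⟨u'', u⟩ = a²|u|² > 0`, a contradiction (`sq_inner_lt_of_not_parallel`). At `t = 0`, the mean
value theorem and monotonicity of `h'` identify the limit of the difference quotients with `inf h'`
(`tendsto_of_between_iInf`). -/

/-! ### Topology of the sector. -/

theorem sector_eq_image_exp {δ : ℝ} (hδ : δ < Real.pi / 2) :
    sector δ = Complex.exp '' {z : ℂ | |z.im| < δ} := by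
  ext z
  constructor
  · rintro ⟨hz, harg⟩
    exact ⟨Complex.log z, by simpa [Complex.log_im] using harg, Complex.exp_log hz⟩
  · rintro ⟨w, hw, rfl⟩
    have hw' : |w.im| < δ := hw
    have hpi := Real.pi_pos
    obtain ⟨h1, h2⟩ := abs_lt.mp hw'
    refine ⟨Complex.exp_ne_zero w, ?_⟩
    rwa [← Complex.log_im, Complex.log_exp (by linarith) (by linarith)]

/-- The exponential maps a convex strip onto the sector. Connectedness is needed for the identity
theorem. -/
theorem isPreconnected_sector {δ : ℝ} (hδ : δ < Real.pi / 2) : IsPreconnected (sector δ) := by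
  rw [sector_eq_image_exp hδ]
  refine IsPreconnected.image ?_ _ Complex.continuous_exp.continuousOn
  have : {z : ℂ | |z.im| < δ} = Complex.imLm ⁻¹' Ioo (-δ) δ := by
    ext z; simp [abs_lt]
  rw [this]
  exact ((convex_Ioo (-δ) δ).linear_preimage Complex.imLm).isPreconnected

theorem isOpen_sector {δ : ℝ} (hδ : δ < Real.pi / 2) : IsOpen (sector δ) := by
  rw [isOpen_iff_mem_nhds]
  rintro z ⟨hz, harg⟩
  have hslit : z ∈ Complex.slitPlane :=
    Or.inl ((Complex.abs_arg_lt_pi_div_two_iff.mp (harg.trans hδ)).resolve_right hz)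
  have hcont : ContinuousAt (fun w : ℂ => |w.arg|) z := (Complex.continuousAt_arg hslit).abs
  filter_upwards [isOpen_ne.mem_nhds hz, hcont.eventually_lt_const harg] with w h1 h2
  exact ⟨h1, h2⟩

theorem ofReal_mem_sector {δ t : ℝ} (hδ : 0 < δ) (ht : 0 < t) : (t : ℂ) ∈ sector δ :=
  ⟨by exact_mod_cast ht.ne', by rwa [Complex.arg_ofReal_of_nonneg ht.le, abs_zero]⟩

theorem tendsto_ofReal_nhdsWithin_sector {δ : ℝ} (hδ : 0 < δ) :
    Tendsto (fun t : ℝ => (t : ℂ)) (𝓝[>] 0) (𝓝[sector δ] 0) := by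
  refine tendsto_nhdsWithin_iff.mpr ⟨?_, ?_⟩
  · exact (Complex.continuous_ofReal.tendsto' 0 0 Complex.ofReal_zero).mono_left
      nhdsWithin_le_nhds
  · filter_upwards [self_mem_nhdsWithin] with t ht using ofReal_mem_sector hδ ht

/-! ### Orbits of the semigroup, and numerical range estimates. -/

section Orbit

variable {H : Type*} [NormedAddCommGroup H] [InnerProductSpace ℂ H]
  {δ : ℝ} {T : ℂ → H →L[ℂ] H}

theorem hasDerivAt_comp_ofReal {f : ℂ → H} {f' : H} {t : ℝ} (hf : HasDerivAt f f' (t : ℂ)) :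
    HasDerivAt (fun s : ℝ => f s) f' t := by
  simpa using! hf.scomp t Complex.ofRealCLM.hasDerivAt

theorem IsHolomorphicOn.differentiableOn_orbit (hT : IsHolomorphicOn δ T) (x : H) :
    DifferentiableOn ℂ (fun z => T z x) (sector δ) := fun z hz =>
  (hT.differentiableOn z hz).clm_apply (differentiableWithinAt_const x)

theorem IsHolomorphicOn.tendsto_orbit (hT : IsHolomorphicOn δ T) (hδ : 0 < δ) (x : H) :
    Tendsto (fun t : ℝ => T t x) (𝓝[>] 0) (𝓝 x) :=
  (hT.tendsto_zero x).comp (tendsto_ofReal_nhdsWithin_sector hδ)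

theorem IsHolomorphicOn.orbit_add (hT : IsHolomorphicOn δ T) (hδ : 0 < δ) (x : H)
    {s t : ℝ} (hs : 0 < s) (ht : 0 < t) : T ((s + t : ℝ) : ℂ) x = T s (T t x) := by
  rw [Complex.ofReal_add, hT.map_add _ (ofReal_mem_sector hδ hs) _ (ofReal_mem_sector hδ ht)]
  rfl

theorem IsHolomorphicOn.hasDerivAt_orbit (hT : IsHolomorphicOn δ T) (hδ : 0 < δ)
    (hδ' : δ < Real.pi / 2) (x : H) {t : ℝ} (ht : 0 < t) :
    HasDerivAt (fun s : ℝ => T s x) (deriv (fun z => T z x) t) t :=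
  hasDerivAt_comp_ofReal ((hT.differentiableOn_orbit x).differentiableAt
    ((isOpen_sector hδ').mem_nhds (ofReal_mem_sector hδ ht))).hasDerivAt

/-- Differentiating the semigroup law in `t` shows that `u'` is again a trajectory, so it too lies
in the domain of the generator; this gives `u ∈ D(A²)`. -/
theorem IsHolomorphicOn.deriv_orbit_add (hT : IsHolomorphicOn δ T) (hδ : 0 < δ)
    (hδ' : δ < Real.pi / 2) (x : H) {s t : ℝ} (hs : 0 < s) (ht : 0 < t) :
    deriv (fun z => T z x) ((s + t : ℝ) : ℂ) = T s (deriv (fun z => T z x) t) := by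
  have h1 : HasDerivAt (fun r : ℝ => T ((s + r : ℝ) : ℂ) x)
      (deriv (fun z => T z x) ((s + t : ℝ) : ℂ)) t :=
    (hT.hasDerivAt_orbit hδ hδ' x (add_pos hs ht)).comp_const_add s t
  have h2 : HasDerivAt (fun r : ℝ => T s (T r x)) (T s (deriv (fun z => T z x) t)) t :=
    ((T s).restrictScalars ℝ).hasFDerivAt.comp_hasDerivAt t (hT.hasDerivAt_orbit hδ hδ' x ht)
  refine h1.unique (h2.congr_of_eventuallyEq ?_)
  filter_upwards [Ioi_mem_nhds ht] with r hr using hT.orbit_add hδ x hs hr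

/-- A trajectory that is differentiable at a positive time lies in the domain of the generator
there. -/
theorem Generates.mem_graph_of_hasDerivAt {B : H →ₗ.[ℂ] H} (hB : Generates B T) {u : ℝ → H}
    {u' : H} {t : ℝ} (hu : HasDerivAt u u' t) (hadd : ∀ s : ℝ, 0 < s → u (s + t) = T s (u t)) :
    (u t, u') ∈ B.graph := by
  rw [hB]
  have h := hasDerivAt_iff_tendsto_slope_zero.mp hu
  have h' := h.mono_left (nhdsWithin_mono (0 : ℝ) (fun s (hs : 0 < s) => hs.ne'))
  refine h'.congr' ?_
  filter_upwards [self_mem_nhdsWithin] with s hs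
  rw [← hadd s hs, add_comm t s, ← Complex.ofReal_inv, Complex.coe_smul]

theorem IsHolomorphicOn.hasDerivAt_deriv_orbit [CompleteSpace H] (hT : IsHolomorphicOn δ T)
    (hδ : 0 < δ) (hδ' : δ < Real.pi / 2) (x : H) {t : ℝ} (ht : 0 < t) :
    HasDerivAt (fun s : ℝ => deriv (fun z => T z x) s)
      (deriv (deriv (fun z => T z x)) t) t :=
  hasDerivAt_comp_ofReal
    (((hT.differentiableOn_orbit x).deriv (isOpen_sector hδ')).differentiableAt
      ((isOpen_sector hδ').mem_nhds (ofReal_mem_sector hδ ht))).hasDerivAt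

theorem IsHolomorphicOn.contDiffOn_orbit [CompleteSpace H] (hT : IsHolomorphicOn δ T)
    (hδ : 0 < δ) (hδ' : δ < Real.pi / 2) (x : H) :
    ContDiffOn ℝ ∞ (fun t : ℝ => T t x) (Ioi 0) := by
  have h : ContDiffOn ℂ ∞ (fun z => T z x) (sector δ) :=
    (hT.differentiableOn_orbit x).contDiffOn (isOpen_sector hδ')
  exact (h.restrict_scalars ℝ).comp Complex.ofRealCLM.contDiff.contDiffOn
    (fun t ht => ofReal_mem_sector hδ ht)

/-- A holomorphic semigroup is injective at positive times. -/
theorem IsHolomorphicOn.orbit_ne_zero [CompleteSpace H] (hT : IsHolomorphicOn δ T)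
    (hδ : 0 < δ) (hδ' : δ < Real.pi / 2) {x : H} (hx : x ≠ 0) {t : ℝ} (ht : 0 < t) :
    T t x ≠ 0 := by
  intro h0
  have han : AnalyticOnNhd ℂ (fun z => T z x) (sector δ) :=
    (hT.differentiableOn_orbit x).analyticOnNhd (isOpen_sector hδ')
  have hpt : ((t + 1 : ℝ) : ℂ) ∈ sector δ := ofReal_mem_sector hδ (by linarith)
  have hreal : Tendsto (fun s : ℝ => (s : ℂ)) (𝓝[≠] (t + 1)) (𝓝[≠] ((t + 1 : ℝ) : ℂ)) :=
    Complex.continuous_ofReal.continuousWithinAt.tendsto_nhdsWithin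
      (fun s hs => Complex.ofReal_injective.ne hs)
  -- A zero at `t` propagates to all later times, so zeros accumulate at `t + 1`.
  have hzero : ∀ᶠ s : ℝ in 𝓝[≠] (t + 1), T s x = 0 := by
    filter_upwards [nhdsWithin_le_nhds (Ioi_mem_nhds (show t < t + 1 by linarith))] with s hs
    have := hT.orbit_add hδ x (sub_pos.mpr hs) ht
    rwa [sub_add_cancel, h0, _root_.map_zero] at this
  have heq := han.eqOn_zero_of_preconnected_of_frequently_eq_zero
    (isPreconnected_sector hδ') hpt (hreal.frequently hzero.frequently)
  -- The orbit vanishes on the whole sector, yet tends to `x` at `0`.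
  refine hx (tendsto_nhds_unique (hT.tendsto_orbit hδ x) ?_)
  refine tendsto_const_nhds.congr' ?_
  filter_upwards [self_mem_nhdsWithin] with s hs
  exact (heq (ofReal_mem_sector hδ hs)).symm

theorem re_inner_pos_of_numRange {A : H →ₗ.[ℂ] H} (hA : numRange A ⊆ {z : ℂ | 0 < z.re})
    (x : A.domain) (hx : (x : H) ≠ 0) : 0 < (inner ℂ (x : H) (A x)).re := by
  have hn : 0 < ‖(x : H)‖ := norm_pos_iff.mpr hx
  have hmem := hA ⟨((‖(x : H)‖⁻¹ : ℝ) : ℂ) • x, by simp [norm_smul, hn.ne'], rfl⟩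
  simp only [LinearPMap.map_smul, Submodule.coe_smul, inner_smul_left, inner_smul_right,
    Complex.conj_ofReal, mem_ofPred_eq, Complex.re_ofReal_mul] at hmem
  exact pos_of_mul_pos_right (pos_of_mul_pos_right hmem (by positivity)) (by positivity)

theorem re_inner_nonneg_of_numRange {A : H →ₗ.[ℂ] H} (hA : numRange A ⊆ {z : ℂ | 0 ≤ z.re})
    (x : A.domain) : 0 ≤ (inner ℂ (x : H) (A x)).re := by
  rcases eq_or_ne (x : H) 0 with hx | hx
  · simp [hx]
  have hn : 0 < ‖(x : H)‖ := norm_pos_iff.mpr hx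
  have hmem := hA ⟨((‖(x : H)‖⁻¹ : ℝ) : ℂ) • x, by simp [norm_smul, hn.ne'], rfl⟩
  simp only [LinearPMap.map_smul, Submodule.coe_smul, inner_smul_left, inner_smul_right,
    Complex.conj_ofReal, mem_ofPred_eq, Complex.re_ofReal_mul] at hmem
  exact nonneg_of_mul_nonneg_right (nonneg_of_mul_nonneg_right hmem (by positivity))
    (by positivity)

/-- Rescaling to a unit vector. A real `m` below the extended bound keeps the inequality in `ℝ`. -/
theorem lowerBound_mul_sq_norm_le {A : H →ₗ.[ℂ] H} {m : ℝ} (hm : (m : EReal) ≤ lowerBound A)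
    (x : A.domain) : m * ‖(x : H)‖ ^ 2 ≤ (inner ℂ (x : H) (A x)).re := by
  rcases eq_or_ne (x : H) 0 with hx | hx
  · simp [hx]
  have hn : 0 < ‖(x : H)‖ := norm_pos_iff.mpr hx
  have hmem : inner ℂ ((((‖(x : H)‖⁻¹ : ℝ) : ℂ) • x : A.domain) : H)
      (A (((‖(x : H)‖⁻¹ : ℝ) : ℂ) • x)) ∈ numRange A :=
    ⟨((‖(x : H)‖⁻¹ : ℝ) : ℂ) • x, by simp [norm_smul, hn.ne'], rfl⟩
  have hle := EReal.coe_le_coe_iff.mp (hm.trans (iInf₂_le _ hmem))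
  simp only [LinearPMap.map_smul, Submodule.coe_smul, inner_smul_left, inner_smul_right,
    Complex.conj_ofReal, Complex.re_ofReal_mul] at hle
  calc m * ‖(x : H)‖ ^ 2
      ≤ ‖(x : H)‖⁻¹ * (‖(x : H)‖⁻¹ * (inner ℂ (x : H) (A x)).re) * ‖(x : H)‖ ^ 2 := by gcongr
    _ = _ := by field_simp

end Orbit

/-! ### Derivatives of the norm along a curve. -/

section NormDerivatives

variable {E : Type*} [NormedAddCommGroup E] [InnerProductSpace ℝ E]

theorem hasDerivWithinAt_norm_of_ne_zero {u : ℝ → E} {u' : E} {s : Set ℝ} {t : ℝ}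
    (hu : HasDerivWithinAt u u' s t) (h0 : u t ≠ 0) :
    HasDerivWithinAt (fun r => ‖u r‖) (inner ℝ (u t) u' / ‖u t‖) s t := by
  have hn : 0 < ‖u t‖ := norm_pos_iff.mpr h0
  have h := hu.norm_sq.sqrt (by positivity)
  simp only [Real.sqrt_sq (norm_nonneg _)] at h
  convert h using 1
  field_simp

theorem hasDerivAt_norm_of_ne_zero {u : ℝ → E} {u' : E} {t : ℝ}
    (hu : HasDerivAt u u' t) (h0 : u t ≠ 0) :
    HasDerivAt (fun r => ‖u r‖) (inner ℝ (u t) u' / ‖u t‖) t := by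
  rw [← hasDerivWithinAt_univ] at hu ⊢
  exact hasDerivWithinAt_norm_of_ne_zero hu h0

theorem deriv_deriv_norm {u v : ℝ → E} {w : E} {t : ℝ}
    (hu : ∀ᶠ s in 𝓝 t, HasDerivAt u (v s) s) (hv : HasDerivAt v w t) (h0 : u t ≠ 0) :
    deriv (deriv fun r => ‖u r‖) t =
      (‖u t‖ ^ 2 * (‖v t‖ ^ 2 + inner ℝ (u t) w) - inner ℝ (u t) (v t) ^ 2) / ‖u t‖ ^ 3 := by
  have hut := hu.self_of_nhds
  have hev : deriv (fun r => ‖u r‖) =ᶠ[𝓝 t] fun s => inner ℝ (u s) (v s) / ‖u s‖ := by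
    filter_upwards [hu, hut.continuousAt.eventually_ne h0] with s hs hs0
    exact (hasDerivAt_norm_of_ne_zero hs hs0).deriv
  have hn : ‖u t‖ ≠ 0 := norm_ne_zero_iff.mpr h0
  rw [hev.deriv_eq, ((hut.inner ℝ hv).fun_div (hasDerivAt_norm_of_ne_zero hut h0) hn).deriv,
    real_inner_self_eq_norm_sq]
  field_simp
  ring

/-- Equality in Cauchy-Schwarz forces `v` to be a multiple of `u`. -/
theorem sq_inner_lt_of_not_parallel {u v : E} {c : ℝ} (hu : u ≠ 0) (hc : 0 ≤ c)
    (h : ∀ a : ℝ, v = a • u → 0 < c) :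
    inner ℝ u v ^ 2 < ‖u‖ ^ 2 * (‖v‖ ^ 2 + c) := by
  have hn : 0 < ‖u‖ := norm_pos_iff.mpr hu
  have hcs : inner ℝ u v ^ 2 ≤ (‖u‖ * ‖v‖) ^ 2 :=
    sq_le_sq' (by linarith [abs_le.mp (abs_real_inner_le_norm u v)]) (real_inner_le_norm u v)
  rcases hc.eq_or_lt with rfl | hc
  · refine lt_of_le_of_ne (by linarith [mul_pow ‖u‖ ‖v‖ 2]) fun heq => ?_
    have habs : |inner ℝ u v| = ‖u‖ * ‖v‖ := by
      rw [← abs_of_nonneg (by positivity : 0 ≤ ‖u‖ * ‖v‖), ← sq_eq_sq_iff_abs_eq_abs, heq]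
      ring
    have := (norm_inner_eq_norm_iff (𝕜 := ℝ) (x := u) (y := v) hu ?_).mp habs
    · obtain ⟨r, -, hr⟩ := this
      exact (h r hr).false
    -- The case `v = 0` is the multiple `a = 0`.
    · rintro rfl
      exact (h 0 (by simp)).false
  · have := mul_pos (pow_pos hn 2) hc
    nlinarith [mul_pow ‖u‖ ‖v‖ 2]

end NormDerivatives

/-! ### Monotone derivatives and the behaviour at the end point. -/

section RealFunctions

variable {h : ℝ → ℝ}

theorem exists_deriv_eq_slope_zero (hc : ContinuousOn h (Ici 0))
    (hd : ∀ t, 0 < t → DifferentiableAt ℝ h t) {t : ℝ} (ht : 0 < t) :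
    ∃ s ∈ Ioo 0 t, deriv h s = (h t - h 0) / t := by
  obtain ⟨s, hs, hs'⟩ := exists_deriv_eq_slope h ht (hc.mono Icc_subset_Ici_self)
    (fun r hr => (hd r hr.1).differentiableWithinAt)
  exact ⟨s, hs, by rw [hs', sub_zero]⟩

/-- A monotone `g` tends to its infimum, possibly `-∞`, at `0⁺`, and `f t` is a value of `g` at some
point of `(0, t]`. It serves both for difference quotients and for `h'` itself. -/
theorem tendsto_of_between_iInf {f g : ℝ → ℝ} (hg : MonotoneOn g (Ioi 0))
    (hf : ∀ t, 0 < t → ∃ s ∈ Ioc 0 t, f t = g s) :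
    Tendsto (fun t => (f t : EReal)) (𝓝[>] 0) (𝓝 (⨅ t ∈ Ioi (0 : ℝ), (g t : EReal))) := by
  refine tendsto_order.mpr ⟨fun a ha => ?_, fun a ha => ?_⟩
  · filter_upwards [self_mem_nhdsWithin] with t ht
    obtain ⟨s, hs, hst⟩ := hf t ht
    rw [hst]
    exact ha.trans_le (iInf₂_le s hs.1)
  · obtain ⟨r, hr, hra⟩ := by simpa only [iInf_lt_iff] using ha
    filter_upwards [Ioo_mem_nhdsGT (mem_Ioi.mp hr)] with t ht
    obtain ⟨s, hs, hst⟩ := hf t ht.1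
    rw [hst]
    exact lt_of_le_of_lt (EReal.coe_le_coe_iff.mpr (hg hs.1 hr (hs.2.trans ht.2.le))) hra

/-- If `h'` is monotone on the open half-line and `h` has a right derivative at the end point,
then `h` is `C¹` up to that point. -/
theorem contDiffOn_one_Ici (hc : ContinuousOn h (Ici 0)) (hs : ContDiffOn ℝ ∞ h (Ioi 0))
    (hmono : MonotoneOn (deriv h) (Ioi 0)) {d : ℝ} (hd : HasDerivWithinAt h d (Ici 0) 0) :
    ContDiffOn ℝ 1 h (Ici 0) := by
  have hdiff : ∀ t, 0 < t → DifferentiableAt ℝ h t := fun t ht =>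
    (hs.contDiffAt (Ioi_mem_nhds ht)).differentiableAt (by simp)
  have hslope : Tendsto (fun t => (((h t - h 0) / t : ℝ) : EReal)) (𝓝[>] 0) (𝓝 (d : EReal)) := by
    have := hasDerivWithinAt_iff_tendsto_slope.mp hd
    rw [Ici_sdiff_left] at this
    refine (continuous_coe_real_ereal.tendsto d).comp (this.congr fun t => ?_)
    rw [slope_def_field, sub_zero]
  -- The slopes tend both to `d` and to `inf h'`, so the infimum is `d`.
  have hinf := tendsto_nhds_unique hslope (tendsto_of_between_iInf hmono fun t ht => by
    obtain ⟨s, hs, hst⟩ := exists_deriv_eq_slope_zero hc hdiff ht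
    exact ⟨s, Ioo_subset_Ioc_self hs, hst.symm⟩)
  have hlim : Tendsto (deriv h) (𝓝[>] 0) (𝓝 d) := by
    have := tendsto_of_between_iInf hmono (f := deriv h) fun t ht => ⟨t, ⟨ht, le_rfl⟩, rfl⟩
    rw [← hinf] at this
    exact EReal.tendsto_coe.mp this
  have hdw : ∀ t, 0 < t → derivWithin h (Ici 0) t = deriv h t := fun t ht =>
    derivWithin_of_mem_nhds (Ici_mem_nhds ht)
  have hdw0 : derivWithin h (Ici 0) 0 = d := hd.derivWithin (uniqueDiffOn_Ici 0 0 self_mem_Ici)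
  rw [contDiffOn_one_iff_derivWithin (uniqueDiffOn_Ici 0)]
  refine ⟨fun t ht => ?_, fun t ht => ?_⟩
  · rcases (mem_Ici.mp ht).eq_or_lt with rfl | ht
    · exact hd.differentiableWithinAt
    · exact (hdiff t ht).differentiableWithinAt
  · rcases (mem_Ici.mp ht).eq_or_lt with rfl | ht
    · rw [← continuousWithinAt_Ioi_iff_Ici, ContinuousWithinAt, hdw0]
      refine hlim.congr' ?_
      filter_upwards [self_mem_nhdsWithin] with t ht using (hdw t ht).symm
    · have hcd : ContinuousAt (deriv h) t :=
        (hs.continuousOn_deriv_of_isOpen isOpen_Ioi (by simp)).continuousAt (Ioi_mem_nhds ht)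
      refine (hcd.congr ?_).continuousWithinAt
      filter_upwards [Ioi_mem_nhds ht] with r hr using (hdw r hr).symm

end RealFunctions

end HolSemigroup

open HolSemigroup

/-! ### The height function. -/

theorem proposition3 {H : Type*} [NormedAddCommGroup H] [InnerProductSpace ℂ H] [CompleteSpace H]
    (A : H →ₗ.[ℂ] H) (T : ℂ → H →L[ℂ] H)
    (hT : HolSemigroup.IsBoundedHolomorphic T)
    (hgen : HolSemigroup.Generates (-A) T)
    (hA : HolSemigroup.numRange A ⊆ {z : ℂ | 0 < z.re})
    (hA2 : HolSemigroup.numRange (HolSemigroup.sq A) ⊆ {z : ℂ | 0 ≤ z.re})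
    (u₀ : H) (hu₀ : u₀ ≠ 0) :
    StrictConvexOn ℝ (Ici (0 : ℝ)) (HolSemigroup.height T u₀) ∧
    StrictAntiOn (HolSemigroup.height T u₀) (Ici (0 : ℝ)) ∧
    ContDiffOn ℝ ∞ (HolSemigroup.height T u₀) (Ioi (0 : ℝ)) ∧
    (∀ t : ℝ, 0 < t → 0 < deriv (deriv (HolSemigroup.height T u₀)) t) ∧
    (∃ d : EReal,
      Tendsto
        (fun t : ℝ =>
          (((HolSemigroup.height T u₀ t - HolSemigroup.height T u₀ 0) / t : ℝ) : EReal))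
        (𝓝[>] (0 : ℝ)) (𝓝 d) ∧
      d ≤ 0 ∧
      d = ⨅ t ∈ Ioi (0 : ℝ), ((deriv (HolSemigroup.height T u₀) t : ℝ) : EReal) ∧
      (‖u₀‖ = 1 → d ≤ -HolSemigroup.lowerBound A)) ∧
    (∀ hD : u₀ ∈ A.domain, ‖u₀‖ = 1 →
      HasDerivWithinAt (HolSemigroup.height T u₀) (-(inner ℂ u₀ (A ⟨u₀, hD⟩)).re)
        (Ici (0 : ℝ)) 0 ∧
      ContDiffOn ℝ 1 (HolSemigroup.height T u₀) (Ici (0 : ℝ))) := by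
  -- The real inner product is the real part of the complex one.
  let _ : InnerProductSpace ℝ H := InnerProductSpace.complexToReal
  obtain ⟨⟨δ, hδ, hδ', hT⟩, -⟩ := hT
  set U : ℂ → H := fun z => T z u₀
  have hne : ∀ t : ℝ, 0 < t → T t u₀ ≠ 0 := fun t ht => hT.orbit_ne_zero hδ hδ' hu₀ ht
  have hu' : ∀ t : ℝ, 0 < t → HasDerivAt (fun s : ℝ => T s u₀) (deriv U t) t :=
    fun t ht => hT.hasDerivAt_orbit hδ hδ' u₀ ht
  have hu'' : ∀ t : ℝ, 0 < t → HasDerivAt (fun s : ℝ => deriv U s) (deriv (deriv U) t) t :=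
    fun t ht => hT.hasDerivAt_deriv_orbit hδ hδ' u₀ ht
  have hval : ∀ x y : H, (x, y) ∈ (-A).graph → ∃ hx : x ∈ A.domain, A ⟨x, hx⟩ = -y := by
    intro x y hxy
    obtain ⟨z, rfl, hz⟩ := (LinearPMap.mem_graph_iff _).mp hxy
    refine ⟨z.2, ?_⟩
    rw [← show _ = y from hz, LinearPMap.neg_apply, neg_neg]
    rfl
  have hAu : ∀ t : ℝ, 0 < t → ∃ hx : T t u₀ ∈ A.domain, A ⟨_, hx⟩ = -deriv U t := fun t ht =>
    hval _ _ (hgen.mem_graph_of_hasDerivAt (hu' t ht) fun s hs => hT.orbit_add hδ u₀ hs ht)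
  have hAv : ∀ t : ℝ, 0 < t → ∃ hx : deriv U t ∈ A.domain, A ⟨_, hx⟩ = -deriv (deriv U) t :=
    fun t ht => hval _ _ (hgen.mem_graph_of_hasDerivAt (hu'' t ht)
      fun s hs => hT.deriv_orbit_add hδ hδ' u₀ hs ht)
  have hA2u : ∀ t : ℝ, 0 < t → 0 ≤ inner ℝ (T t u₀) (deriv (deriv U) t) := by
    intro t ht
    obtain ⟨hx, hxe⟩ := hAu t ht
    obtain ⟨hy, hye⟩ := hAv t ht
    have hmem : A ⟨_, hx⟩ ∈ A.domain := by rw [hxe]; exact A.domain.neg_mem hy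
    have h := re_inner_nonneg_of_numRange hA2 ⟨T t u₀, hx, hmem⟩
    have hsq : sq A ⟨T t u₀, hx, hmem⟩ = deriv (deriv U) t := by
      change A ⟨A ⟨_, hx⟩, hmem⟩ = _
      have : (⟨A ⟨_, hx⟩, hmem⟩ : A.domain) = -⟨_, hy⟩ := Subtype.ext hxe
      rw [this, LinearPMap.map_neg, hye, neg_neg]
    rwa [hsq] at h
  have hAre : ∀ t : ℝ, 0 < t → inner ℝ (T t u₀) (deriv U t) < 0 := by
    intro t ht
    obtain ⟨hx, hxe⟩ := hAu t ht
    have h := re_inner_pos_of_numRange hA ⟨_, hx⟩ (hne t ht)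
    rw [hxe, inner_neg_right, Complex.neg_re] at h
    exact neg_pos.mp h
  have hh' : ∀ t : ℝ, 0 < t → HasDerivAt (height T u₀)
      (inner ℝ (T t u₀) (deriv U t) / ‖T t u₀‖) t := fun t ht =>
    hasDerivAt_norm_of_ne_zero (hu' t ht) (hne t ht)
  have hneg : ∀ t : ℝ, 0 < t → deriv (height T u₀) t < 0 := fun t ht => by
    rw [(hh' t ht).deriv]
    exact div_neg_of_neg_of_pos (hAre t ht) (norm_pos_iff.mpr (hne t ht))
  have hh'' : ∀ t : ℝ, 0 < t → 0 < deriv (deriv (height T u₀)) t := by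
    intro t ht
    have hev : ∀ᶠ s : ℝ in 𝓝 t, HasDerivAt (fun r : ℝ => T r u₀) (deriv U s) s := by
      filter_upwards [Ioi_mem_nhds ht] with s hs using hu' s hs
    have heq := deriv_deriv_norm hev (hu'' t ht) (hne t ht)
    change deriv (deriv (height T u₀)) t = _ at heq
    rw [heq]
    refine div_pos (sub_pos.mpr ?_) (pow_pos (norm_pos_iff.mpr (hne t ht)) 3)
    refine sq_inner_lt_of_not_parallel (hne t ht) (hA2u t ht) fun a ha => ?_
    obtain ⟨hx, hxe⟩ := hAu t ht
    obtain ⟨hy, hye⟩ := hAv t ht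
    have ha0 : a ≠ 0 := by
      rintro rfl
      have := hAre t ht
      rw [ha, zero_smul, inner_zero_right] at this
      exact this.false
    have hsm : (⟨deriv U t, hy⟩ : A.domain) = (a : ℂ) • ⟨T t u₀, hx⟩ :=
      Subtype.ext (ha.trans (Complex.coe_smul a (T t u₀)).symm)
    -- Apply `-A` to `u' = au`.
    have hw : deriv (deriv U) t = (a * a) • T t u₀ := by
      rw [hsm, LinearPMap.map_smul, hxe, ha, smul_neg, neg_inj, Complex.coe_smul] at hye
      rw [← hye, smul_smul]
    rw [hw, real_inner_smul_right, real_inner_self_eq_norm_sq]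
    exact mul_pos (mul_self_pos.mpr ha0) (pow_pos (norm_pos_iff.mpr (hne t ht)) 2)
  have hsmooth : ContDiffOn ℝ ∞ (height T u₀) (Ioi 0) :=
    (hT.contDiffOn_orbit hδ hδ' u₀).norm ℝ hne
  have h0 : height T u₀ 0 = ‖u₀‖ := by simp [height, hT.map_zero]
  have hlim0 : Tendsto (height T u₀) (𝓝[>] 0) (𝓝 ‖u₀‖) := (hT.tendsto_orbit hδ u₀).norm
  have hcont : ContinuousOn (height T u₀) (Ici 0) := by
    intro t ht
    rcases (mem_Ici.mp ht).eq_or_lt with rfl | ht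
    · rw [← continuousWithinAt_Ioi_iff_Ici, ContinuousWithinAt, h0]
      exact hlim0
    · exact (hh' t ht).continuousAt.continuousWithinAt
  have hmono' : StrictMonoOn (deriv (height T u₀)) (Ioi 0) := by
    refine strictMonoOn_of_deriv_pos (convex_Ioi 0)
      (hsmooth.continuousOn_deriv_of_isOpen isOpen_Ioi (by simp)) fun t ht => ?_
    rw [interior_Ioi] at ht
    exact hh'' t ht
  refine ⟨?_, ?_, hsmooth, hh'', ⟨⨅ t ∈ Ioi (0 : ℝ), ((deriv (height T u₀) t : ℝ) : EReal),
    ?_, ?_, rfl, ?_⟩, ?_⟩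
  · refine StrictMonoOn.strictConvexOn_of_deriv (convex_Ici 0) hcont ?_
    rwa [interior_Ici]
  · refine strictAntiOn_of_deriv_neg (convex_Ici 0) hcont fun t ht => ?_
    rw [interior_Ici] at ht
    exact hneg t ht
  · refine tendsto_of_between_iInf hmono'.monotoneOn fun t ht => ?_
    obtain ⟨s, hs, hst⟩ :=
      exists_deriv_eq_slope_zero hcont (fun r hr => (hh' r hr).differentiableAt) ht
    exact ⟨s, Ioo_subset_Ioc_self hs, hst.symm⟩
  · exact (iInf₂_le (1 : ℝ) (mem_Ioi.mpr one_pos)).trans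
      (by exact_mod_cast (hneg 1 one_pos).le)
  · intro hu1
    -- It suffices to treat each real `m < m(A)`: then `h' ≤ -m h` on `t > 0`, and `h → 1` as `t →
    -- 0⁺`.
    refine EReal.le_neg_of_le_neg (EReal.ge_of_forall_gt_iff_ge.mp fun m hm => ?_)
    have hbound : ∀ t : ℝ, 0 < t →
        (⨅ t ∈ Ioi (0 : ℝ), ((deriv (height T u₀) t : ℝ) : EReal)) ≤
          ((-m * height T u₀ t : ℝ) : EReal) := by
      intro t ht
      refine (iInf₂_le t (mem_Ioi.mpr ht)).trans (EReal.coe_le_coe_iff.mpr ?_)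
      obtain ⟨hx, hxe⟩ := hAu t ht
      have h := lowerBound_mul_sq_norm_le hm.le ⟨_, hx⟩
      rw [hxe, inner_neg_right, Complex.neg_re] at h
      have hn : 0 < ‖T t u₀‖ := norm_pos_iff.mpr (hne t ht)
      have h' : m * ‖T t u₀‖ ^ 2 ≤ -inner ℝ (T t u₀) (deriv U t) := h
      rw [(hh' t ht).deriv, div_le_iff₀ hn]
      change _ ≤ -m * ‖T t u₀‖ * ‖T t u₀‖
      linarith
    have hlim : Tendsto (fun t => ((-m * height T u₀ t : ℝ) : EReal)) (𝓝[>] 0)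
        (𝓝 ((-m : ℝ) : EReal)) := by
      refine (continuous_coe_real_ereal.tendsto (-m)).comp ?_
      simpa [hu1] using hlim0.const_mul (-m)
    have := ge_of_tendsto hlim (eventually_mem_nhdsWithin.mono hbound)
    rw [EReal.coe_neg] at this
    exact EReal.le_neg_of_le_neg this
  · intro hD hu1
    have hgraph : (u₀, -A ⟨u₀, hD⟩) ∈ (-A).graph :=
      (LinearPMap.mem_graph_iff _).mpr ⟨⟨u₀, hD⟩, rfl, LinearPMap.neg_apply _ _⟩
    have hT0 : T ((0 : ℝ) : ℂ) u₀ = u₀ := by simp [hT.map_zero]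
    have hder : HasDerivWithinAt (fun t : ℝ => T t u₀) (-A ⟨u₀, hD⟩) (Ici 0) 0 := by
      rw [hasDerivWithinAt_iff_tendsto_slope, Ici_sdiff_left]
      refine ((hgen _ _).mp hgraph).congr fun t => ?_
      rw [slope_def_module, hT0, sub_zero, ← Complex.ofReal_inv, Complex.coe_smul]
    have hd : HasDerivWithinAt (height T u₀) (-(inner ℂ u₀ (A ⟨u₀, hD⟩)).re) (Ici 0) 0 := by
      have h := hasDerivWithinAt_norm_of_ne_zero hder (by rwa [hT0])
      rw [hT0, hu1, div_one, inner_neg_right] at h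
      exact h
    exact ⟨hd, contDiffOn_one_Ici hcont hsmooth hmono'.monotoneOn hd⟩
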